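/- Let $M$ be a smooth $n$-manifold, $\psi=(\psi_1,\dots,\psi_{n+2}):M\to S^{n+1}\subset E^{n+2}$ a smooth immersion into the unit round sphere, and $\nu$ a smooth unit normal field of $M$ in $S^{n+1}$. In local coordinates let $g_{ij}=\langle\partial_i\psi,\partial_j\psi\rangle$, $A_{ij}=\langle\nabla^{S^{n+1}}_{\partial_i}\partial_j\psi,\nu\rangle$, and let $A=(g^{jk}A_{ik})$ be the shape operator; let $\psi_{a,ij}$ be the second covariant derivative of $\psi_a$ with respect to $g$. Let $\mu_0$ be a real function on $M$ (for example a constant) and put $$\sigma_k^\infty=\sum_{j=0}^{k}\frac{\mu_0^j}{j!}\,\sigma_{k-j}(A)\quad(k\ge 0),\qquad \sigma_k^\infty=0\quad(k<0),\qquad T_k^\infty=\sum_{j=0}^{k}(-1)^j\sigma_{k-j}^\infty A^j,$$ where $\sigma_k(A)$ is the $k$-th elementary symmetric polynomial of the eigenvalues of $A$; indices of $T_k^\infty$ are raised with $g$. Let $r\ge 2$ be an integer, and for a real number $c$ let $(\mathrm{P}_c)$ be the condition that every component $\psi_a$, $1\le a\le n+2$, satisfies on $M$ $$\bigl((r-1)(T_r^\infty)^{ij}-(n-r+1)(T_{r-2}^\infty)^{ij}\bigr)\psi_{a,ij}=c\,\mu_0\,\sigma_{r-2}^\infty\,\nu_a-\Bigl((r-1)\bigl((n-r)\sigma_r^\infty+\mu_0\sigma_{r-1}^\infty\bigr)-(n-r+1)\bigl((n-r+2)\sigma_{r-2}^\infty+\mu_0\sigma_{r-3}^\infty\bigr)\Bigr)\psi_a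 .$$ Then: (i) $(r+1)\sigma_{r+1}^\infty-(n-r+1)\sigma_{r-1}^\infty-\mu_0(\sigma_r^\infty-\sigma_{r-2}^\infty)=0$ on $M$ if and only if $(\mathrm{P}_c)$ holds with $c=n-2r+2$; (ii) $(r+1)\sigma_{r+1}^\infty-(n-r+1)\sigma_{r-1}^\infty-\mu_0(\sigma_r^\infty+\sigma_{r-2}^\infty)=0$ on $M$ (for constant $\mu_0$, the Euler–Lagrange equation of $\int_M\sigma_r^\infty\,dV$) if and only if $(\mathrm{P}_c)$ holds with $c=n$. -/

import Mathlib

open scoped ContDiff Manifold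

noncomputable section

/-- The Euclidean space `E^m`. -/
abbrev Euc (m : ℕ) : Type := EuclideanSpace ℝ (Fin m)

/-! ### Weighted elementary symmetric functions and weighted Newton transformations -/

section Algebra

variable {n : ℕ}

/-- `σ_k(A)`: the `k`-th elementary symmetric polynomial of the eigenvalues of `A`, counted with
multiplicity. It is used for matrices of shape operators, all of whose eigenvalues are real. -/
def sigma (A : Matrix (Fin n) (Fin n) ℝ) (k : ℕ) : ℝ :=
  A.charpoly.roots.esymm k

/-- `σ_k^∞(μ₀, A) = ∑_{j=0}^k (μ₀^j / j!) σ_{k-j}(A)`, and `0` for a negative index `k`. -/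
def wsigma (μ₀ : ℝ) (A : Matrix (Fin n) (Fin n) ℝ) : ℤ → ℝ
  | Int.ofNat k => ∑ j ∈ Finset.range (k + 1), μ₀ ^ j / (j.factorial : ℝ) * sigma A (k - j)
  | Int.negSucc _ => 0

/-- `T_k^∞(μ₀, A) = ∑_{j=0}^k (-1)^j σ_{k-j}^∞(μ₀, A) A^j`. -/
def wnewton (μ₀ : ℝ) (A : Matrix (Fin n) (Fin n) ℝ) (k : ℕ) : Matrix (Fin n) (Fin n) ℝ :=
  ∑ j ∈ Finset.range (k + 1), ((-1 : ℝ) ^ j * wsigma μ₀ A ((k : ℤ) - (j : ℤ))) • A ^ j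

end Algebra

/-! ### Local geometry of a parametrized hypersurface `X` with unit normal `N` -/

section Local

variable {n : ℕ} {F : Type*} [NormedAddCommGroup F] [NormedSpace ℝ F]

/-- The partial derivative `∂f/∂x_i`. -/
def pd (i : Fin n) (f : Euc n → F) (u : Euc n) : F :=
  fderiv ℝ f u (EuclideanSpace.single i 1)

/-- The induced metric `g_ij = ⟨∂X/∂x_i, ∂X/∂x_j⟩`. -/
def metric (X : Euc n → Euc (n + 2)) (u : Euc n) : Matrix (Fin n) (Fin n) ℝ :=
  Matrix.of fun i j => inner ℝ (pd i X u) (pd j X u)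

/-- The inverse metric `g^ij`. -/
def metricInv (X : Euc n → Euc (n + 2)) (u : Euc n) : Matrix (Fin n) (Fin n) ℝ :=
  (metric X u)⁻¹

/-- The Christoffel symbols `Γ^k_ij` of the Levi-Civita connection of the induced metric. -/
def christoffel (X : Euc n → Euc (n + 2)) (u : Euc n) (k i j : Fin n) : ℝ :=
  (1 / 2 : ℝ) * ∑ l, metricInv X u k l *
    (pd i (fun v => metric X v j l) u + pd j (fun v => metric X v i l) u
      - pd l (fun v => metric X v i j) u)

/-- The second covariant derivative `f_{,ij} = ∂²f/∂x_i∂x_j - Γ^k_ij ∂f/∂x_k` for the induced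
metric. -/
def covHess (X : Euc n → Euc (n + 2)) (f : Euc n → ℝ) (u : Euc n) (i j : Fin n) : ℝ :=
  pd i (pd j f) u - ∑ k, christoffel X u k i j * pd k f u

/-- The covariant derivative of the unit sphere along `X`, in the direction `∂/∂x_i`: the component
of `∂V/∂x_i` tangent to the sphere at `X`. -/
def sphereCov (X : Euc n → Euc (n + 2)) (i : Fin n) (V : Euc n → Euc (n + 2)) (u : Euc n) :
    Euc (n + 2) :=
  pd i V u - (inner ℝ (pd i V u) (X u) : ℝ) • X u

/-- The second fundamental form `A_ij = ⟨∇^S_{∂/∂x_i} ∂X/∂x_j, N⟩`. -/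
def secondFF (X N : Euc n → Euc (n + 2)) (u : Euc n) : Matrix (Fin n) (Fin n) ℝ :=
  Matrix.of fun i j => inner ℝ (sphereCov X i (pd j X) u) (N u)

/-- The shape operator: the entry in row `j` and column `i` is `A_i^j = g^{jk} A_{ik}`
(`A` is symmetric). -/
def shapeOp (X N : Euc n → Euc (n + 2)) (u : Euc n) : Matrix (Fin n) (Fin n) ℝ :=
  metricInv X u * secondFF X N u

/-- The Newton tensor `(T_k^∞)^{ij} = (T_k^∞)^i_l g^{lj}`. -/
def newtonUp (μ₀ : ℝ) (X N : Euc n → Euc (n + 2)) (u : Euc n) (k : ℕ) :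
    Matrix (Fin n) (Fin n) ℝ :=
  wnewton μ₀ (shapeOp X N u) k * metricInv X u

end Local

/-! ### Hypersurfaces of the unit sphere -/

section Hypersurface

variable {n : ℕ} {M : Type*} [TopologicalSpace M] [ChartedSpace (Euc n) M]

/-- `ψ` is a smooth immersion of the `n`-manifold `M` into the unit sphere `S^{n+1} ⊂ E^{n+2}` and
`ν` is a smooth unit normal field of it, tangent to the sphere. -/
structure IsSphereHypersurface (ψ ν : M → Euc (n + 2)) : Prop where
  smooth : ContMDiff (𝓡 n) 𝓘(ℝ, Euc (n + 2)) ∞ ψ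
  mem_sphere : ∀ x, ‖ψ x‖ = 1
  immersion : ∀ x, Function.Injective (mfderiv (𝓡 n) 𝓘(ℝ, Euc (n + 2)) ψ x)
  normal_smooth : ContMDiff (𝓡 n) 𝓘(ℝ, Euc (n + 2)) ∞ ν
  normal_unit : ∀ x, ‖ν x‖ = 1
  normal_position : ∀ x, inner ℝ (ψ x) (ν x) = 0
  normal_tangent : ∀ (x : M) (v : TangentSpace (𝓡 n) x),
    inner ℝ (E := Euc (n + 2)) (mfderiv (𝓡 n) 𝓘(ℝ, Euc (n + 2)) ψ x v) (ν x) = 0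

/-- The shape operator of `(ψ, ν)` at `x`, as a matrix in the coordinates given by the chart `φ`. -/
def shapeAt (ψ ν : M → Euc (n + 2)) (φ : OpenPartialHomeomorph M (Euc n)) (x : M) :
    Matrix (Fin n) (Fin n) ℝ :=
  shapeOp (ψ ∘ φ.symm) (ν ∘ φ.symm) (φ x)

/-- `σ_k^∞` of the hypersurface at `x`, computed in the chart `φ`. -/
def sigmaAt (μ₀ : M → ℝ) (ψ ν : M → Euc (n + 2)) (φ : OpenPartialHomeomorph M (Euc n)) (x : M)
    (k : ℤ) : ℝ :=
  wsigma (μ₀ x) (shapeAt ψ ν φ x) k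

/-- The equation `(r+1) σ_{r+1}^∞ - (n-r+1) σ_{r-1}^∞ - μ₀ (σ_r^∞ + ε σ_{r-2}^∞) = 0` holds
identically on `M`. -/
def MinimalEq (ε : ℝ) (μ₀ : M → ℝ) (ψ ν : M → Euc (n + 2)) (r : ℕ) : Prop :=
  ∀ φ ∈ IsManifold.maximalAtlas (𝓡 n) ∞ M, ∀ x ∈ φ.source,
    ((r : ℝ) + 1) * sigmaAt μ₀ ψ ν φ x ((r : ℤ) + 1)
      - ((n : ℝ) - r + 1) * sigmaAt μ₀ ψ ν φ x ((r : ℤ) - 1)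
      - μ₀ x * (sigmaAt μ₀ ψ ν φ x r + ε * sigmaAt μ₀ ψ ν φ x ((r : ℤ) - 2)) = 0

/-- Each component `ψ_a` of the position vector satisfies, in all local coordinates,
`((r-1) T_r^∞ - (n-r+1) T_{r-2}^∞)^{ij} ψ_{a,ij} = c μ₀ σ_{r-2}^∞ ν_a
  - ((r-1)((n-r) σ_r^∞ + μ₀ σ_{r-1}^∞) - (n-r+1)((n-r+2) σ_{r-2}^∞ + μ₀ σ_{r-3}^∞)) ψ_a`. -/
def PositionPDE (c : ℝ) (μ₀ : M → ℝ) (ψ ν : M → Euc (n + 2)) (r : ℕ) : Prop :=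
  ∀ a : Fin (n + 2), ∀ φ ∈ IsManifold.maximalAtlas (𝓡 n) ∞ M, ∀ x ∈ φ.source,
    ∑ i, ∑ j,
      (((r : ℝ) - 1) * newtonUp (μ₀ x) (ψ ∘ φ.symm) (ν ∘ φ.symm) (φ x) r i j
        - ((n : ℝ) - r + 1) * newtonUp (μ₀ x) (ψ ∘ φ.symm) (ν ∘ φ.symm) (φ x) (r - 2) i j)
        * covHess (ψ ∘ φ.symm) (fun u => ψ (φ.symm u) a) (φ x) i j
    = c * μ₀ x * sigmaAt μ₀ ψ ν φ x ((r : ℤ) - 2) * ν x a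
      - (((r : ℝ) - 1) * (((n : ℝ) - r) * sigmaAt μ₀ ψ ν φ x r
            + μ₀ x * sigmaAt μ₀ ψ ν φ x ((r : ℤ) - 1))
          - ((n : ℝ) - r + 1) * (((n : ℝ) - r + 2) * sigmaAt μ₀ ψ ν φ x ((r : ℤ) - 2)
            + μ₀ x * sigmaAt μ₀ ψ ν φ x ((r : ℤ) - 3))) * ψ x a

end Hypersurface

end

/-!
In a chart `φ`, with `X = ψ ∘ φ⁻¹` and `N = ν ∘ φ⁻¹`, the Gauss formula reads
`X_{a,ij} = A_ij N_a - g_ij X_a`, so contraction with `Q g⁻¹` gives `tr (Q A) N_a - tr Q X_a` for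
every matrix `Q`. For `Q = (r-1) T_r^∞ - (n-r+1) T_{r-2}^∞` both traces come from the generating
series `∑ σ_k^∞ t^k = e^{μ₀ t} det (1 + t A)`: its logarithmic derivative is
`μ₀ + tr (A (1 + t A)⁻¹)`, and `tr (T_k^∞ A)` is the `k`-th coefficient of
`tr (A (1 + t A)⁻¹) e^{μ₀ t} det (1 + t A)`. The coefficient of `X_a` is then the one in `(P_c)`
identically, while for `c = n - r + 1 + ε (r - 1)` the coefficient of `N_a` exceeds the one in
`(P_c)` by `r - 1` times the left side of the curvature equation with sign `ε`. Since `N ≠ 0`,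
`(P_c)` is equivalent to that equation; `ε = -1` and `ε = 1` are the two claims.
-/

theorem succ_mul_esymm_eq_sum_antidiagonal (σ R : Type*) [Fintype σ] [CommRing R] (k : ℕ) :
    ((k : MvPolynomial σ R) + 1) * MvPolynomial.esymm σ R (k + 1) =
      ∑ p ∈ Finset.HasAntidiagonal.antidiagonal k,
        MvPolynomial.esymm σ R p.1 * ((-1) ^ p.2 * MvPolynomial.psum σ R (p.2 + 1)) := by
  have newton := MvPolynomial.mul_esymm_eq_sum σ R (k + 1)
  rw [Finset.sum_filter, Finset.Nat.sum_antidiagonal_succ', if_neg (lt_irrefl _), zero_add,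
    Finset.mul_sum] at newton
  rw [← Nat.cast_succ, newton]
  refine Finset.sum_congr rfl fun p hp => ?_
  have hsum : p.1 + p.2 = k := Finset.HasAntidiagonal.mem_antidiagonal.1 hp
  have hsign : (-1 : MvPolynomial σ R) ^ (k + 1 + 1) * (-1) ^ p.1 = (-1) ^ p.2 := by
    rw [← hsum, ← pow_add, show p.1 + p.2 + 1 + 1 + p.1 = 2 * (p.1 + 1) + p.2 by ring, pow_add,
      pow_mul, neg_one_sq, one_pow, one_mul]
  rw [if_pos (by lia), ← hsign]
  ring

section Diagonalizable

open Matrix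

variable {ι R : Type*} [Fintype ι] [DecidableEq ι] [CommRing R]

/-- `A` is similar to a diagonal matrix over the ring of its entries. For such real `A`,
the function `sigma`, defined by the real roots of the characteristic polynomial, misses no
eigenvalue. -/
def IsDiagonalizable (A : Matrix ι ι R) : Prop :=
  ∃ (P : (Matrix ι ι R)ˣ) (d : ι → R),
    A = (P : Matrix ι ι R) * diagonal d * (↑P⁻¹ : Matrix ι ι R)

theorem IsDiagonalizable.units_conj {A : Matrix ι ι R} (hA : IsDiagonalizable A)
    (Q : (Matrix ι ι R)ˣ) :
    IsDiagonalizable ((Q : Matrix ι ι R) * A * (↑Q⁻¹ : Matrix ι ι R)) := by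
  obtain ⟨P, d, rfl⟩ := hA
  exact ⟨Q * P, d, by simp only [_root_.mul_inv_rev, Units.val_mul, mul_assoc]⟩

theorem trace_units_conj_diagonal_pow (P : (Matrix ι ι R)ˣ) (d : ι → R) (k : ℕ) :
    (((P : Matrix ι ι R) * diagonal d * (↑P⁻¹ : Matrix ι ι R)) ^ k).trace = ∑ i, d i ^ k := by
  rw [Units.conj_pow, trace_units_conj, diagonal_pow, trace_diagonal]
  rfl

theorem roots_charpoly_units_conj_diagonal [IsDomain R] (P : (Matrix ι ι R)ˣ) (d : ι → R) :
    ((P : Matrix ι ι R) * diagonal d * (↑P⁻¹ : Matrix ι ι R)).charpoly.roots =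
      Finset.univ.val.map d := by
  have hroots := Polynomial.roots_multiset_prod_X_sub_C (Finset.univ.val.map d)
  rw [Multiset.map_map] at hroots
  rw [coe_units_inv, charpoly_units_conj, charpoly_diagonal]
  exact hroots

variable {𝕜 : Type*} [RCLike 𝕜]

theorem isDiagonalizable_of_isHermitian {A : Matrix ι ι 𝕜} (hA : A.IsHermitian) :
    IsDiagonalizable A :=
  ⟨Unitary.toUnits hA.eigenvectorUnitary, _, hA.spectral_theorem⟩

open scoped ComplexOrder MatrixOrder Matrix.Norms.L2Operator in
/-- Writing `G = Bᴴ B`, the product `G S = Bᴴ (B S Bᴴ) (Bᴴ)⁻¹` is similar to a Hermitian matrix. -/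
theorem isDiagonalizable_posDef_mul_isHermitian {G S : Matrix ι ι 𝕜} (hG : G.PosDef)
    (hS : S.IsHermitian) : IsDiagonalizable (G * S) := by
  obtain ⟨B, rfl⟩ := CStarAlgebra.nonneg_iff_eq_star_mul_self.mp hG.posSemidef.nonneg
  obtain ⟨Q, hQ⟩ : IsUnit Bᴴ := isUnit_of_mul_isUnit_left hG.isUnit
  have hconj : star B * B * S = Q * (B * S * Bᴴ) * (↑Q⁻¹ : Matrix ι ι 𝕜) := by
    rw [← hQ, ← mul_assoc, Units.mul_inv_cancel_right, hQ, star_eq_conjTranspose, mul_assoc]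
  rw [hconj]
  exact (isDiagonalizable_of_isHermitian (isHermitian_mul_mul_conjTranspose B hS)).units_conj Q

end Diagonalizable

section NewtonTransformations

open PowerSeries

theorem derivative_rescale_exp {R : Type*} [CommRing R] [Algebra ℚ R] (a : R) :
    derivative R (rescale a (exp R)) = C a * rescale a (exp R) := by
  ext k
  have hexp : coeff (k + 1) (exp R) * ((k : R) + 1) = coeff k (exp R) := by
    rw [← coeff_derivative, derivative_exp]
  rw [coeff_derivative, coeff_C_mul, coeff_rescale, coeff_rescale, ← hexp]
  ring

variable {n : ℕ}

/-- The generating series `∑ σ_k(A) t^k`. -/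
noncomputable def sigmaSeries (A : Matrix (Fin n) (Fin n) ℝ) : ℝ⟦X⟧ :=
  PowerSeries.mk (sigma A)

/-- The generating series `∑ σ_k^∞(μ₀, A) t^k`. -/
noncomputable def wsigmaSeries (μ₀ : ℝ) (A : Matrix (Fin n) (Fin n) ℝ) : ℝ⟦X⟧ :=
  PowerSeries.mk fun k => wsigma μ₀ A k

/-- The expansion `∑ (-1)^k tr(A^{k+1}) t^k` of `tr (A (1 + tA)⁻¹)`, which is the logarithmic
derivative of `det (1 + tA)`. -/
noncomputable def powerTraceSeries (A : Matrix (Fin n) (Fin n) ℝ) : ℝ⟦X⟧ :=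
  PowerSeries.mk fun k => (-1) ^ k * (A ^ (k + 1)).trace

theorem sigma_units_conj_diagonal (P : (Matrix (Fin n) (Fin n) ℝ)ˣ) (d : Fin n → ℝ) (k : ℕ) :
    sigma ((P : Matrix (Fin n) (Fin n) ℝ) * Matrix.diagonal d * (↑P⁻¹ : Matrix (Fin n) (Fin n) ℝ))
      k = MvPolynomial.aeval d (MvPolynomial.esymm (Fin n) ℝ k) := by
  rw [sigma, roots_charpoly_units_conj_diagonal, MvPolynomial.aeval_esymm_eq_multiset_esymm]

theorem IsDiagonalizable.succ_mul_sigma {A : Matrix (Fin n) (Fin n) ℝ} (hA : IsDiagonalizable A)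
    (k : ℕ) :
    ((k : ℝ) + 1) * sigma A (k + 1) =
      ∑ p ∈ Finset.HasAntidiagonal.antidiagonal k,
        sigma A p.1 * ((-1) ^ p.2 * (A ^ (p.2 + 1)).trace) := by
  obtain ⟨P, d, rfl⟩ := hA
  simp only [sigma_units_conj_diagonal, trace_units_conj_diagonal_pow]
  have newton := congrArg (MvPolynomial.aeval d) (succ_mul_esymm_eq_sum_antidiagonal (Fin n) ℝ k)
  simpa only [map_mul, map_add, map_sum, map_pow, map_neg, map_one, map_natCast,
    MvPolynomial.psum, MvPolynomial.aeval_X] using newton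

theorem IsDiagonalizable.derivative_sigmaSeries {A : Matrix (Fin n) (Fin n) ℝ}
    (hA : IsDiagonalizable A) :
    derivative ℝ (sigmaSeries A) = sigmaSeries A * powerTraceSeries A := by
  ext k
  rw [coeff_derivative, coeff_mul, sigmaSeries, coeff_mk, mul_comm, hA.succ_mul_sigma]
  simp only [powerTraceSeries, coeff_mk]

theorem wsigmaSeries_eq_rescale_exp_mul (μ₀ : ℝ) (A : Matrix (Fin n) (Fin n) ℝ) :
    wsigmaSeries μ₀ A = rescale μ₀ (exp ℝ) * sigmaSeries A := by
  ext k
  rw [coeff_mul, Finset.Nat.sum_antidiagonal_eq_sum_range_succ_mk, wsigmaSeries, coeff_mk]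
  exact Finset.sum_congr rfl fun j _ => by simp [sigmaSeries, div_eq_mul_inv]

theorem IsDiagonalizable.derivative_wsigmaSeries {A : Matrix (Fin n) (Fin n) ℝ}
    (hA : IsDiagonalizable A) (μ₀ : ℝ) :
    derivative ℝ (wsigmaSeries μ₀ A) =
      C μ₀ * wsigmaSeries μ₀ A + powerTraceSeries A * wsigmaSeries μ₀ A := by
  rw [wsigmaSeries_eq_rescale_exp_mul, Derivation.leibniz, derivative_rescale_exp,
    hA.derivative_sigmaSeries, smul_eq_mul, smul_eq_mul]
  ring

theorem trace_wnewton_mul_self_eq_coeff (μ₀ : ℝ) (A : Matrix (Fin n) (Fin n) ℝ) (k : ℕ) :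
    (wnewton μ₀ A k * A).trace = coeff k (powerTraceSeries A * wsigmaSeries μ₀ A) := by
  rw [coeff_mul, Finset.Nat.sum_antidiagonal_eq_sum_range_succ_mk, wnewton, Finset.sum_mul,
    Matrix.trace_sum]
  refine Finset.sum_congr rfl fun j hj => ?_
  have hjk : j ≤ k := Finset.mem_range_succ_iff.1 hj
  rw [smul_mul_assoc, ← pow_succ, Matrix.trace_smul, powerTraceSeries, wsigmaSeries, coeff_mk,
    coeff_mk, Nat.cast_sub hjk, smul_eq_mul]
  ring

theorem IsDiagonalizable.trace_wnewton_mul_self {A : Matrix (Fin n) (Fin n) ℝ}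
    (hA : IsDiagonalizable A) (μ₀ : ℝ) (k : ℕ) :
    (wnewton μ₀ A k * A).trace = ((k : ℝ) + 1) * wsigma μ₀ A (k + 1) - μ₀ * wsigma μ₀ A k := by
  have hcoeff := congrArg (coeff k) (hA.derivative_wsigmaSeries μ₀)
  rw [map_add, ← trace_wnewton_mul_self_eq_coeff, coeff_derivative, coeff_C_mul, wsigmaSeries,
    coeff_mk, coeff_mk, Nat.cast_succ] at hcoeff
  linarith

theorem wnewton_succ (μ₀ : ℝ) (A : Matrix (Fin n) (Fin n) ℝ) (k : ℕ) :
    wnewton μ₀ A (k + 1) = wsigma μ₀ A (k + 1) • 1 - wnewton μ₀ A k * A := by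
  have hterm (j : ℕ) :
      ((-1 : ℝ) ^ (j + 1) * wsigma μ₀ A ((k + 1 : ℕ) - (j + 1 : ℕ))) • A ^ (j + 1) =
        -(((-1 : ℝ) ^ j * wsigma μ₀ A (k - j)) • A ^ j * A) := by
    rw [Nat.cast_succ, Nat.cast_succ, add_sub_add_right_eq_sub, pow_succ (-1 : ℝ), mul_neg_one,
      neg_mul, neg_smul, pow_succ, smul_mul_assoc]
  rw [wnewton, Finset.sum_range_succ', Finset.sum_congr rfl fun j _ => hterm j,
    Finset.sum_neg_distrib, ← Finset.sum_mul, ← wnewton]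
  simp [sub_eq_neg_add]

theorem IsDiagonalizable.trace_wnewton {A : Matrix (Fin n) (Fin n) ℝ} (hA : IsDiagonalizable A)
    (μ₀ : ℝ) (k : ℕ) :
    (wnewton μ₀ A k).trace =
      ((n : ℝ) - k) * wsigma μ₀ A k + μ₀ * wsigma μ₀ A ((k : ℤ) - 1) := by
  cases k with
  | zero =>
    have hneg : wsigma μ₀ A (-1) = 0 := rfl
    simp [wnewton, hneg, mul_comm]
  | succ k =>
    rw [wnewton_succ, Matrix.trace_sub, hA.trace_wnewton_mul_self, Matrix.trace_smul,
      Matrix.trace_one, Fintype.card_fin, Nat.cast_succ, Nat.cast_succ, add_sub_cancel_right,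
      smul_eq_mul]
    ring

/-- The expression `(r+1) σ_{r+1}^∞ - (n-r+1) σ_{r-1}^∞ - μ₀ (σ_r^∞ + ε σ_{r-2}^∞)` whose vanishing
is `MinimalEq`. -/
noncomputable def minimalOperator (ε μ₀ : ℝ) (A : Matrix (Fin n) (Fin n) ℝ) (r : ℕ) : ℝ :=
  ((r : ℝ) + 1) * wsigma μ₀ A ((r : ℤ) + 1) - ((n : ℝ) - r + 1) * wsigma μ₀ A ((r : ℤ) - 1)
    - μ₀ * (wsigma μ₀ A r + ε * wsigma μ₀ A ((r : ℤ) - 2))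

/-- The matrix `(r-1) T_r^∞ - (n-r+1) T_{r-2}^∞` of the second-order operator in `PositionPDE`. -/
noncomputable def positionNewton (μ₀ : ℝ) (A : Matrix (Fin n) (Fin n) ℝ) (r : ℕ) :
    Matrix (Fin n) (Fin n) ℝ :=
  ((r : ℝ) - 1) • wnewton μ₀ A r - ((n : ℝ) - r + 1) • wnewton μ₀ A (r - 2)

theorem IsDiagonalizable.trace_positionNewton {A : Matrix (Fin n) (Fin n) ℝ}
    (hA : IsDiagonalizable A) (μ₀ : ℝ) {r : ℕ} (hr : 2 ≤ r) :
    (positionNewton μ₀ A r).trace =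
      ((r : ℝ) - 1) * (((n : ℝ) - r) * wsigma μ₀ A r + μ₀ * wsigma μ₀ A ((r : ℤ) - 1))
        - ((n : ℝ) - r + 1) * (((n : ℝ) - r + 2) * wsigma μ₀ A ((r : ℤ) - 2)
          + μ₀ * wsigma μ₀ A ((r : ℤ) - 3)) := by
  rw [positionNewton, Matrix.trace_sub, Matrix.trace_smul, Matrix.trace_smul, hA.trace_wnewton,
    hA.trace_wnewton, Nat.cast_sub hr, Nat.cast_sub hr, Nat.cast_ofNat, Nat.cast_ofNat,
    show (r : ℤ) - 2 - 1 = r - 3 by ring, smul_eq_mul, smul_eq_mul]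
  ring

theorem IsDiagonalizable.trace_positionNewton_mul_self {A : Matrix (Fin n) (Fin n) ℝ}
    (hA : IsDiagonalizable A) (ε μ₀ : ℝ) {r : ℕ} (hr : 2 ≤ r) :
    (positionNewton μ₀ A r * A).trace =
      ((n : ℝ) - r + 1 + ε * ((r : ℝ) - 1)) * μ₀ * wsigma μ₀ A ((r : ℤ) - 2)
        + ((r : ℝ) - 1) * minimalOperator ε μ₀ A r := by
  rw [positionNewton, sub_mul, smul_mul_assoc, smul_mul_assoc, Matrix.trace_sub,
    Matrix.trace_smul, Matrix.trace_smul, hA.trace_wnewton_mul_self, hA.trace_wnewton_mul_self,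
    Nat.cast_sub hr, Nat.cast_sub hr, Nat.cast_ofNat, Nat.cast_ofNat,
    show (r : ℤ) - 2 + 1 = r - 1 by ring, minimalOperator, smul_eq_mul, smul_eq_mul]
  ring

end NewtonTransformations

theorem sum_mul_eq_trace_mul {ι R : Type*} [Fintype ι] [NonUnitalSemiring R] (A : Matrix ι ι R)
    {S : Matrix ι ι R} (hS : S.IsSymm) : ∑ i, ∑ j, A i j * S i j = (A * S).trace := by
  have hadamard : ∑ i, ∑ j, A i j * S i j = (A * S.transpose).trace := Matrix.sum_hadamard_eq A S
  rwa [hS.eq] at hadamard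

theorem eq_zero_of_inner_eq_zero_of_card_add_card_eq_finrank {𝕜 E ι κ : Type*} [RCLike 𝕜]
    [NormedAddCommGroup E] [InnerProductSpace 𝕜 E] [FiniteDimensional 𝕜 E] [Fintype ι] [Fintype κ]
    {b : ι → E} {c : κ → E} (hb : LinearIndependent 𝕜 b) (hc : LinearIndependent 𝕜 c)
    (hbc : ∀ i k, inner 𝕜 (b i) (c k) = 0)
    (hcard : Fintype.card ι + Fintype.card κ = Module.finrank 𝕜 E) {v : E}
    (hvb : ∀ i, inner 𝕜 v (b i) = 0) (hvc : ∀ k, inner 𝕜 v (c k) = 0) : v = 0 := by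
  have hortho : Submodule.span 𝕜 (Set.range b) ⟂ Submodule.span 𝕜 (Set.range c) := by
    rw [Submodule.isOrtho_span]
    rintro _ ⟨i, rfl⟩ _ ⟨k, rfl⟩
    exact hbc i k
  have hspan : Submodule.span 𝕜 (Set.range (Sum.elim b c)) = ⊤ :=
    (hb.sum_type hc hortho.disjoint).span_eq_top_of_card_eq_finrank' (by rwa [Fintype.card_sum])
  have hv : Submodule.span 𝕜 {v} ⟂ Submodule.span 𝕜 (Set.range (Sum.elim b c)) := by
    rw [Submodule.isOrtho_span]
    rintro _ rfl _ ⟨i | k, rfl⟩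
    · exact hvb i
    · exact hvc k
  rwa [hspan, Submodule.isOrtho_top_right, Submodule.span_singleton_eq_bot] at hv

section PartialDerivatives

open scoped Topology

variable {n : ℕ} {F : Type*} [NormedAddCommGroup F] [NormedSpace ℝ F] {u : Euc n}

theorem contDiffAt_pd {f : Euc n → F} {k m : ℕ∞ω} (hf : ContDiffAt ℝ k f u) (hmk : m + 1 ≤ k)
    (i : Fin n) : ContDiffAt ℝ m (pd i f) u :=
  (hf.fderiv_right hmk).clm_apply contDiffAt_const

theorem pd_congr {f g : Euc n → F} (hfg : f =ᶠ[𝓝 u] g) (i : Fin n) : pd i f u = pd i g u := by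
  rw [pd, pd, hfg.fderiv_eq]

theorem pd_const (c : F) (i : Fin n) : pd i (fun _ : Euc n => c) u = 0 := by
  rw [pd, fderiv_fun_const, Pi.zero_apply, zero_apply]

theorem pd_clm_comp {F' : Type*} [NormedAddCommGroup F'] [NormedSpace ℝ F'] (L : F →L[ℝ] F')
    {f : Euc n → F} (hf : DifferentiableAt ℝ f u) (i : Fin n) :
    pd i (fun v => L (f v)) u = L (pd i f u) :=
  congrArg (fun T => T (EuclideanSpace.single i 1))
    (L.hasFDerivAt.comp u hf.hasFDerivAt).fderiv

theorem pd_apply {m : ℕ} {f : Euc n → Euc m} (hf : DifferentiableAt ℝ f u) (i : Fin n)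
    (a : Fin m) : pd i (fun v => f v a) u = pd i f u a :=
  pd_clm_comp (EuclideanSpace.proj a : Euc m →L[ℝ] ℝ) hf i

theorem pd_inner {E : Type*} [NormedAddCommGroup E] [InnerProductSpace ℝ E] {f g : Euc n → E}
    (hf : DifferentiableAt ℝ f u) (hg : DifferentiableAt ℝ g u) (i : Fin n) :
    pd i (fun v => (inner ℝ (f v) (g v) : ℝ)) u =
      inner ℝ (f u) (pd i g u) + inner ℝ (pd i f u) (g u) :=
  fderiv_inner_apply ℝ hf hg _

theorem pd_pd_eq_fderiv_fderiv {f : Euc n → F} (hf : DifferentiableAt ℝ (fderiv ℝ f) u)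
    (i j : Fin n) :
    pd i (pd j f) u =
      fderiv ℝ (fderiv ℝ f) u (EuclideanSpace.single i 1) (EuclideanSpace.single j 1) :=
  pd_clm_comp (ContinuousLinearMap.apply ℝ F (EuclideanSpace.single j 1)) hf i

theorem pd_pd_comm {f : Euc n → F} (hf : ContDiffAt ℝ 2 f u) (i j : Fin n) :
    pd i (pd j f) u = pd j (pd i f) u := by
  have hdf : DifferentiableAt ℝ (fderiv ℝ f) u :=
    (hf.fderiv_right (m := 1) one_add_one_eq_two.le).differentiableAt one_ne_zero
  rw [pd_pd_eq_fderiv_fderiv hdf, pd_pd_eq_fderiv_fderiv hdf]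
  exact hf.isSymmSndFDerivAt minSmoothness_of_isRCLikeNormedField.le _ _

theorem linearIndependent_pd {f : Euc n → F} (hf : Function.Injective (fderiv ℝ f u)) :
    LinearIndependent ℝ fun i => pd i f u := by
  have hpd : (fun i => pd i f u) =
      (fderiv ℝ f u).toLinearMap ∘ (EuclideanSpace.basisFun (Fin n) ℝ).toBasis := by
    funext i
    simp [pd]
  rw [hpd]
  exact (EuclideanSpace.basisFun (Fin n) ℝ).toBasis.linearIndependent.map' _
    (LinearMap.ker_eq_bot.2 hf)

end PartialDerivatives

section InducedMetric

variable {n : ℕ} {X : Euc n → Euc (n + 2)} {u : Euc n}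

theorem metric_posDef (himm : LinearIndependent ℝ fun i => pd i X u) : (metric X u).PosDef :=
  Matrix.posDef_gram_of_linearIndependent himm

theorem isUnit_det_metric (himm : LinearIndependent ℝ fun i => pd i X u) :
    IsUnit (metric X u).det :=
  (metric_posDef himm).det_pos.ne'.isUnit

theorem metric_isSymm (X : Euc n → Euc (n + 2)) (u : Euc n) : (metric X u).IsSymm :=
  Matrix.IsSymm.ext fun i j => real_inner_comm (pd i X u) (pd j X u)

theorem differentiableAt_pd (hX : ContDiffAt ℝ 2 X u) (i : Fin n) :
    DifferentiableAt ℝ (pd i X) u :=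
  (contDiffAt_pd hX one_add_one_eq_two.le i).differentiableAt one_ne_zero

theorem pd_metric (hX : ContDiffAt ℝ 2 X u) (i j k : Fin n) :
    pd i (fun v => metric X v j k) u =
      inner ℝ (pd i (pd k X) u) (pd j X u) + inner ℝ (pd i (pd j X) u) (pd k X u) := by
  rw [real_inner_comm (pd j X u)]
  exact pd_inner (differentiableAt_pd hX j) (differentiableAt_pd hX k) i

theorem christoffel_eq_mulVec (hX : ContDiffAt ℝ 2 X u) (k i j : Fin n) :
    christoffel X u k i j =
      (metricInv X u).mulVec (fun l => inner ℝ (pd i (pd j X) u) (pd l X u)) k := by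
  have koszul (l : Fin n) :
      pd i (fun v => metric X v j l) u + pd j (fun v => metric X v i l) u
        - pd l (fun v => metric X v i j) u = 2 * inner ℝ (pd i (pd j X) u) (pd l X u) := by
    rw [pd_metric hX, pd_metric hX, pd_metric hX, pd_pd_comm hX j i, pd_pd_comm hX l i,
      pd_pd_comm hX l j]
    ring
  simp only [christoffel, koszul, Matrix.mulVec, dotProduct, Finset.mul_sum]
  exact Finset.sum_congr rfl fun l _ => by ring

theorem inner_sum_christoffel_smul_pd (hX : ContDiffAt ℝ 2 X u)
    (himm : LinearIndependent ℝ fun i => pd i X u) (i j l : Fin n) :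
    inner ℝ (∑ k, christoffel X u k i j • pd k X u) (pd l X u) =
      inner ℝ (pd i (pd j X) u) (pd l X u) := by
  set w : Fin n → ℝ := fun l => inner ℝ (pd i (pd j X) u) (pd l X u)
  calc inner ℝ (∑ k, christoffel X u k i j • pd k X u) (pd l X u)
      = ∑ k, metric X u l k * christoffel X u k i j := by
        rw [real_inner_comm, inner_sum]
        exact Finset.sum_congr rfl fun k _ => by rw [real_inner_smul_right, mul_comm]; rfl
    _ = (metric X u).mulVec ((metricInv X u).mulVec w) l := by
        simp only [christoffel_eq_mulVec hX, Matrix.mulVec, dotProduct, w]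
    _ = w l := by
        rw [metricInv, Matrix.mulVec_mulVec, Matrix.mul_nonsing_inv _ (isUnit_det_metric himm),
          Matrix.one_mulVec]

end InducedMetric

section SphereHypersurface

open scoped Topology

variable {n : ℕ}

/-- A hypersurface of the unit sphere with its unit normal at one point `u`, parametrized by `X`
near `u`. Second order contact being all that the Gauss formula sees, `X` is only `C^2` and `N` is
prescribed at `u` alone. -/
structure IsSphereHypersurfaceAt (X N : Euc n → Euc (n + 2)) (u : Euc n) : Prop where
  contDiffAt : ContDiffAt ℝ 2 X u
  eventually_norm_eq_one : ∀ᶠ v in 𝓝 u, ‖X v‖ = 1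
  linearIndependent_pd : LinearIndependent ℝ fun i => pd i X u
  norm_normal : ‖N u‖ = 1
  inner_position_normal : inner ℝ (X u) (N u) = (0 : ℝ)
  inner_pd_normal : ∀ i, inner ℝ (pd i X u) (N u) = (0 : ℝ)

namespace IsSphereHypersurfaceAt

variable {X N : Euc n → Euc (n + 2)} {u : Euc n}

theorem eventually_differentiableAt (h : IsSphereHypersurfaceAt X N u) :
    ∀ᶠ v in 𝓝 u, DifferentiableAt ℝ X v :=
  (h.contDiffAt.eventually (by simp)).mono fun _ hv => hv.differentiableAt two_ne_zero

theorem norm_position (h : IsSphereHypersurfaceAt X N u) : ‖X u‖ = 1 :=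
  h.eventually_norm_eq_one.self_of_nhds

theorem eventually_inner_pd_position (h : IsSphereHypersurfaceAt X N u) (i : Fin n) :
    ∀ᶠ v in 𝓝 u, inner ℝ (pd i X v) (X v) = (0 : ℝ) := by
  filter_upwards [h.eventually_norm_eq_one.eventually_nhds, h.eventually_differentiableAt]
    with v hnorm hdiff
  have hconst : (fun w => (inner ℝ (X w) (X w) : ℝ)) =ᶠ[𝓝 v] fun _ => 1 :=
    hnorm.mono fun w hw => by simp only [real_inner_self_eq_norm_sq, hw, one_pow]
  have hpd := pd_congr hconst i
  rw [pd_inner hdiff hdiff, pd_const, real_inner_comm] at hpd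
  linarith

theorem inner_pd_position (h : IsSphereHypersurfaceAt X N u) (i : Fin n) :
    inner ℝ (pd i X u) (X u) = (0 : ℝ) :=
  (h.eventually_inner_pd_position i).self_of_nhds

theorem inner_pd_pd_position (h : IsSphereHypersurfaceAt X N u) (i j : Fin n) :
    inner ℝ (pd i (pd j X) u) (X u) = -metric X u i j := by
  have hpd : pd i (fun v => (inner ℝ (pd j X v) (X v) : ℝ)) u = pd i (fun _ => 0) u :=
    pd_congr (h.eventually_inner_pd_position j) i
  rw [pd_inner (differentiableAt_pd h.contDiffAt j) (h.contDiffAt.differentiableAt two_ne_zero),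
    pd_const, real_inner_comm] at hpd
  exact eq_neg_of_add_eq_zero_right hpd

theorem secondFF_apply (h : IsSphereHypersurfaceAt X N u) (i j : Fin n) :
    secondFF X N u i j = inner ℝ (pd i (pd j X) u) (N u) := by
  rw [secondFF, Matrix.of_apply, sphereCov, inner_sub_left, real_inner_smul_left,
    h.inner_position_normal, mul_zero, sub_zero]

theorem secondFF_isSymm (h : IsSphereHypersurfaceAt X N u) : (secondFF X N u).IsSymm :=
  Matrix.IsSymm.ext fun i j => by
    rw [h.secondFF_apply, h.secondFF_apply, pd_pd_comm h.contDiffAt]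

theorem isDiagonalizable_shapeOp (h : IsSphereHypersurfaceAt X N u) :
    IsDiagonalizable (shapeOp X N u) :=
  isDiagonalizable_posDef_mul_isHermitian (metric_posDef h.linearIndependent_pd).inv
    (Matrix.isHermitian_iff_isSymm.2 h.secondFF_isSymm)

theorem eq_zero_of_inner_eq_zero (h : IsSphereHypersurfaceAt X N u) {v : Euc (n + 2)}
    (hpd : ∀ i, inner ℝ v (pd i X u) = (0 : ℝ)) (hposition : inner ℝ v (X u) = (0 : ℝ))
    (hnormal : inner ℝ v (N u) = (0 : ℝ)) : v = 0 := by
  have horthonormal : Orthonormal ℝ ![X u, N u] := by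
    simp [orthonormal_vecCons_iff, h.norm_position, h.norm_normal, h.inner_position_normal]
  refine eq_zero_of_inner_eq_zero_of_card_add_card_eq_finrank h.linearIndependent_pd
    horthonormal.linearIndependent (fun i => Fin.forall_fin_two.2 ⟨?_, ?_⟩) (by simp) hpd
    (Fin.forall_fin_two.2 ⟨hposition, hnormal⟩)
  · exact h.inner_pd_position i
  · exact h.inner_pd_normal i

theorem gauss_formula (h : IsSphereHypersurfaceAt X N u) (i j : Fin n) :
    pd i (pd j X) u - ∑ k, christoffel X u k i j • pd k X u =
      secondFF X N u i j • N u - metric X u i j • X u := by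
  refine sub_eq_zero.1 (h.eq_zero_of_inner_eq_zero (fun l => ?_) ?_ ?_)
  · simp only [inner_sub_left, real_inner_smul_left, real_inner_comm (pd l X u) (N u),
      real_inner_comm (pd l X u) (X u), h.inner_pd_normal, h.inner_pd_position,
      inner_sum_christoffel_smul_pd h.contDiffAt h.linearIndependent_pd]
    ring
  · simp only [inner_sub_left, sum_inner, real_inner_smul_left, real_inner_comm (X u) (N u),
      h.inner_position_normal, h.inner_pd_position, h.inner_pd_pd_position,
      real_inner_self_eq_norm_sq, h.norm_position, mul_zero, Finset.sum_const_zero]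
    ring
  · simp only [inner_sub_left, sum_inner, real_inner_smul_left, h.secondFF_apply,
      h.inner_pd_normal, h.inner_position_normal, real_inner_self_eq_norm_sq, h.norm_normal,
      mul_zero, Finset.sum_const_zero]
    ring

theorem covHess_apply (h : IsSphereHypersurfaceAt X N u) (a : Fin (n + 2)) (i j : Fin n) :
    covHess X (fun v => X v a) u i j = secondFF X N u i j * N u a - metric X u i j * X u a := by
  have hpd : pd j (fun v => X v a) =ᶠ[𝓝 u] fun v => pd j X v a :=
    h.eventually_differentiableAt.mono fun v hv => pd_apply hv j a
  have hgauss := congrArg (fun v : Euc (n + 2) => v a) (h.gauss_formula i j)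
  simp only [PiLp.sub_apply, PiLp.smul_apply, smul_eq_mul, WithLp.ofLp_sum, Finset.sum_apply]
    at hgauss
  simp only [covHess, pd_congr hpd, pd_apply (differentiableAt_pd h.contDiffAt j),
    pd_apply h.eventually_differentiableAt.self_of_nhds, hgauss]

theorem sum_mul_metricInv_mul_covHess (h : IsSphereHypersurfaceAt X N u)
    (Q : Matrix (Fin n) (Fin n) ℝ) (a : Fin (n + 2)) :
    ∑ i, ∑ j, (Q * metricInv X u) i j * covHess X (fun v => X v a) u i j =
      (Q * shapeOp X N u).trace * N u a - Q.trace * X u a := by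
  have hsecond : ∑ i, ∑ j, (Q * metricInv X u) i j * secondFF X N u i j =
      (Q * shapeOp X N u).trace := by
    rw [shapeOp, ← mul_assoc, sum_mul_eq_trace_mul _ h.secondFF_isSymm]
  have hmetric : ∑ i, ∑ j, (Q * metricInv X u) i j * metric X u i j = Q.trace := by
    rw [sum_mul_eq_trace_mul _ (metric_isSymm X u), mul_assoc, metricInv,
      Matrix.nonsing_inv_mul _ (isUnit_det_metric h.linearIndependent_pd), mul_one]
  simp only [h.covHess_apply, mul_sub, Finset.sum_sub_distrib, ← hsecond, ← hmetric,
    Finset.sum_mul, mul_assoc]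

end IsSphereHypersurfaceAt

end SphereHypersurface

theorem mdifferentiable_of_mem_maximalAtlas {𝕜 E H M : Type*} [NontriviallyNormedField 𝕜]
    [NormedAddCommGroup E] [NormedSpace 𝕜 E] [TopologicalSpace H] {I : ModelWithCorners 𝕜 E H}
    [TopologicalSpace M] [ChartedSpace H M] {k : ℕ∞ω} (hk : k ≠ 0) {φ : OpenPartialHomeomorph M H}
    (hφ : φ ∈ IsManifold.maximalAtlas I k M) : φ.MDifferentiable I I :=
  ⟨(contMDiffOn_of_mem_maximalAtlas hφ).mdifferentiableOn hk,
    (contMDiffOn_symm_of_mem_maximalAtlas hφ).mdifferentiableOn hk⟩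

section Charts

variable {n : ℕ} {M : Type*} [TopologicalSpace M] [ChartedSpace (Euc n) M]

namespace IsSphereHypersurface

variable {ψ ν : M → Euc (n + 2)} {φ : OpenPartialHomeomorph M (Euc n)} {x : M}

theorem isSphereHypersurfaceAt (h : IsSphereHypersurface ψ ν)
    (hφ : φ ∈ IsManifold.maximalAtlas (𝓡 n) ∞ M) (hx : x ∈ φ.source) :
    IsSphereHypersurfaceAt (ψ ∘ φ.symm) (ν ∘ φ.symm) (φ x) := by
  have hψ : ContMDiffAt (𝓡 n) 𝓘(ℝ, Euc (n + 2)) ∞ (ψ ∘ φ.symm) (φ x) :=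
    (h.smooth _).comp _ (contMDiffAt_symm_of_mem_maximalAtlas hφ (φ.map_source hx))
  have hφd : φ.MDifferentiable (𝓡 n) (𝓡 n) :=
    mdifferentiable_of_mem_maximalAtlas (by simp) hφ
  have hchain : fderiv ℝ (ψ ∘ φ.symm) (φ x) =
      (mfderiv (𝓡 n) 𝓘(ℝ, Euc (n + 2)) ψ (φ.symm (φ x))).comp
        (mfderiv (𝓡 n) (𝓡 n) φ.symm (φ x)) := by
    rw [← mfderiv_eq_fderiv]
    exact mfderiv_comp (φ x) ((h.smooth _).mdifferentiableAt (by simp))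
      (hφd.mdifferentiableAt_symm (φ.map_source hx))
  refine ⟨contDiffAt_infty.1 hψ.contDiffAt 2, .of_forall fun v => h.mem_sphere _,
    linearIndependent_pd ?_, h.normal_unit _, h.normal_position _, fun i => ?_⟩
  · rw [hchain]
    exact (h.immersion _).comp (hφd.symm.mfderiv_injective (φ.map_source hx))
  · rw [pd, hchain]
    exact h.normal_tangent _ _

theorem exists_normal_apply_ne_zero (h : IsSphereHypersurface ψ ν) (x : M) : ∃ a, ν x a ≠ 0 := by
  by_contra! hν
  have hzero : ν x = 0 := PiLp.ext hν
  simpa [hzero] using h.normal_unit x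

theorem sum_newtonUp_mul_covHess (h : IsSphereHypersurface ψ ν)
    (hφ : φ ∈ IsManifold.maximalAtlas (𝓡 n) ∞ M) (hx : x ∈ φ.source) (μ₀ : ℝ) (r : ℕ)
    (a : Fin (n + 2)) :
    ∑ i, ∑ j,
      (((r : ℝ) - 1) * newtonUp μ₀ (ψ ∘ φ.symm) (ν ∘ φ.symm) (φ x) r i j
        - ((n : ℝ) - r + 1) * newtonUp μ₀ (ψ ∘ φ.symm) (ν ∘ φ.symm) (φ x) (r - 2) i j)
        * covHess (ψ ∘ φ.symm) (fun u => ψ (φ.symm u) a) (φ x) i j =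
      (positionNewton μ₀ (shapeAt ψ ν φ x) r * shapeAt ψ ν φ x).trace * ν x a
        - (positionNewton μ₀ (shapeAt ψ ν φ x) r).trace * ψ x a := by
  have hcontract := (h.isSphereHypersurfaceAt hφ hx).sum_mul_metricInv_mul_covHess
    (positionNewton μ₀ (shapeAt ψ ν φ x) r) a
  simpa only [positionNewton, sub_mul, smul_mul_assoc, Matrix.sub_apply, Matrix.smul_apply,
    smul_eq_mul, newtonUp, shapeAt, Function.comp_apply, φ.left_inv hx] using hcontract

end IsSphereHypersurface

end Charts

theorem mainTheorem5_general {n : ℕ} {M : Type*} [TopologicalSpace M] [ChartedSpace (Euc n) M]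
    {ψ ν : M → Euc (n + 2)} (hψ : IsSphereHypersurface ψ ν) (ε : ℝ) (μ₀ : M → ℝ) {r : ℕ}
    (hr : 2 ≤ r) :
    MinimalEq ε μ₀ ψ ν r ↔ PositionPDE ((n : ℝ) - r + 1 + ε * (r - 1)) μ₀ ψ ν r := by
  have hr₁ : (r : ℝ) - 1 ≠ 0 := sub_ne_zero.2 (mod_cast (by lia : r ≠ 1))
  have diagonalizable {φ} (hφ : φ ∈ IsManifold.maximalAtlas (𝓡 n) ∞ M) {x} (hx : x ∈ φ.source) :
      IsDiagonalizable (shapeAt ψ ν φ x) :=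
    (hψ.isSphereHypersurfaceAt hφ hx).isDiagonalizable_shapeOp
  constructor
  · intro hmin a φ hφ x hx
    have hA := diagonalizable hφ hx
    have hop : minimalOperator ε (μ₀ x) (shapeAt ψ ν φ x) r = 0 := hmin φ hφ x hx
    rw [hψ.sum_newtonUp_mul_covHess hφ hx, hA.trace_positionNewton _ hr,
      hA.trace_positionNewton_mul_self ε _ hr, hop, mul_zero, add_zero]
    rfl
  · intro hpde φ hφ x hx
    have hA := diagonalizable hφ hx
    obtain ⟨a, ha⟩ := hψ.exists_normal_apply_ne_zero x
    have hop := hpde a φ hφ x hx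
    rw [hψ.sum_newtonUp_mul_covHess hφ hx, hA.trace_positionNewton _ hr,
      hA.trace_positionNewton_mul_self ε _ hr, add_mul] at hop
    have hzero : ((r : ℝ) - 1) * minimalOperator ε (μ₀ x) (shapeAt ψ ν φ x) r * ν x a = 0 := by
      simp only [sigmaAt] at hop
      linarith
    exact (mul_eq_zero.1 ((mul_eq_zero.1 hzero).resolve_right ha)).resolve_left hr₁

theorem mainTheorem5 {n : ℕ} {M : Type*} [TopologicalSpace M] [ChartedSpace (Euc n) M]
    [IsManifold (𝓡 n) ∞ M] (ψ ν : M → Euc (n + 2)) (hψ : IsSphereHypersurface ψ ν)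
    (μ₀ : M → ℝ) (r : ℕ) (hr : 2 ≤ r) :
    (MinimalEq (-1) μ₀ ψ ν r ↔ PositionPDE ((n : ℝ) - 2 * r + 2) μ₀ ψ ν r) ∧
    (MinimalEq 1 μ₀ ψ ν r ↔ PositionPDE (n : ℝ) μ₀ ψ ν r) := by
  constructor <;> convert mainTheorem5_general hψ _ μ₀ hr using 2 <;> ring
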